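/- Let $(\mathcal B,\mathbb E,\mathfrak s)$ be an extriangulated category (in the sense of Nakaoka--Palu), with underlying additive category $\mathcal B$. Call $A\to B\to C$ a conflation if it realizes some $\delta\in\mathbb E(C,A)$. Let $\mathcal P\subseteq\mathcal B$ be the full subcategory of projective objects, i.e. of the objects $P$ with $\mathbb E(P,-)=0$, and assume that $\mathcal B$ has enough projectives: for every $B\in\mathcal B$ there is a conflation $X\to P\to B$ with $P\in\mathcal P$. A cotorsion pair on $\mathcal B$ is a pair $(\mathcal U,\mathcal V)$ of full additive subcategories, closed under isomorphisms and direct summands, such that $\mathbb E(\mathcal U,\mathcal V)=0$ and such that every $B\in\mathcal B$ admits conflations $V_B\to U_B\to B$ and $B\to V^B\to U^B$ with $U_B,U^B\in\mathcal U$ and $V_B,V^B\in\mathcal V$. Let $(\mathcal U,\mathcal V)$ be a cotorsion pair on $\mathcal B$, and put $\mathcal W=\mathcal U\cap\mathcal V$. - The heart $\underline{\mathcal H}$ of $(\mathcal U,\mathcal V)$ is $(\mathcal B^+\cap\mathcal B^-)/\mathcal W$. It is a full subcategory of the quotient category $\mathcal B/\mathcal W$, in which the morphisms that factor through an object of $\mathcal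 W$ are zero. Here $\mathcal B^+$ (resp. $\mathcal B^-$) consists of the objects $B$ which admit a conflation $V\to W\to B$ with $V\in\mathcal V$, $W\in\mathcal W$ (resp. $B\to W\to U$ with $W\in\mathcal W$, $U\in\mathcal U$). - The kernel $\mathcal K$ of $(\mathcal U,\mathcal V)$ is the closure under direct summands in $\mathcal B$ of the class of objects $X$ which admit a conflation $U\to X\to V$ with $U\in\mathcal U$, $V\in\mathcal V$. - The coheart of $(\mathcal U,\mathcal V)$ is $\mathcal C=\{X\in\mathcal U\mid \mathbb E(X,U)=0\text{ for all }U\in\mathcal U\}$. For an additive category $\mathcal A$, let $\mathrm{mod}\,\mathcal A$ be the category of coherent functors on $\mathcal A$, i.e. of the additive functors $F\colon\mathcal A^{\mathrm{op}}\to \mathrm{Ab}$ which admit an exact sequence $\mathcal A(-,X)\to\mathcal A(-,Y)\to F\to 0$ with $X,Y\in\mathcal A$; its morphisms are the natural transformations. If $(\mathcal C,\mathcal K)$ is a cotorsion pair on $\mathcal B$, then there is an additive equivalence of categories $$\underline{\mathcal H}\simeq\mathrm{mod}(\mathcal C/\mathcal P),$$ where $\mathcal C/\mathcal P$ is the full subcategory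 on the objects of $\mathcal C$ of the quotient category $\mathcal B/\mathcal P$, in which the morphisms that factor through a projective object are zero. -/

import Mathlib

open CategoryTheory CategoryTheory.Limits Opposite

universe w v u

noncomputable section

namespace Extri

/-! ### Quotients of additive categories by full subcategories -/

section AdditiveQuotient

variable {B : Type u} [Category.{v} B] [Preadditive B]

/-- The morphism `f` factors through an object of the full subcategory `W`. -/
def FactorsThru (W : ObjectProperty B) {X Y : B} (f : X ⟶ Y) : Prop :=
  ∃ (Z : B) (_ : W Z) (i : X ⟶ Z) (p : Z ⟶ Y), i ≫ p = f

/-- The group `[W](X, Y)` of the ideal of `B` generated by the objects of `W`. If `W` is closed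
under finite direct sums, then this is the set of the morphisms which factor through an object
of `W`; see `mem_ideal_iff`. -/
def ideal (W : ObjectProperty B) (X Y : B) : AddSubgroup (X ⟶ Y) :=
  AddSubgroup.closure {f | FactorsThru W f}

theorem mem_ideal_iff [HasBinaryBiproducts B] (W : ObjectProperty B) [W.ContainsZero]
    (hW : ∀ X Y : B, W X → W Y → W (X ⊞ Y)) {X Y : B} (f : X ⟶ Y) :
    f ∈ ideal W X Y ↔ FactorsThru W f := by
  refine ⟨fun h => ?_, fun h => AddSubgroup.subset_closure h⟩
  induction h using AddSubgroup.closure_induction with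
  | mem f hf => exact hf
  | zero =>
    obtain ⟨Z, _, hZ⟩ := ObjectProperty.ContainsZero.exists_zero (P := W)
    exact ⟨Z, hZ, 0, 0, by simp⟩
  | add f g _ _ hf hg =>
    obtain ⟨Z, hZ, i, p, rfl⟩ := hf
    obtain ⟨Z', hZ', i', p', rfl⟩ := hg
    exact ⟨Z ⊞ Z', hW _ _ hZ hZ', biprod.lift i i', biprod.desc p p', by simp⟩
  | neg f _ hf =>
    obtain ⟨Z, hZ, i, p, rfl⟩ := hf
    exact ⟨Z, hZ, -i, p, by simp⟩

theorem comp_mem_ideal (W : ObjectProperty B) {X Y Z : B} (f : X ⟶ Y) {g : Y ⟶ Z}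
    (hg : g ∈ ideal W Y Z) : f ≫ g ∈ ideal W X Z := by
  induction hg using AddSubgroup.closure_induction with
  | mem g hg =>
    obtain ⟨Q, hQ, i, p, rfl⟩ := hg
    exact AddSubgroup.subset_closure ⟨Q, hQ, f ≫ i, p, by simp⟩
  | zero => simp
  | add g h _ _ hg hh => simpa using add_mem hg hh
  | neg g _ hg => simpa using hg

theorem mem_ideal_comp (W : ObjectProperty B) {X Y Z : B} {f : X ⟶ Y} (g : Y ⟶ Z)
    (hf : f ∈ ideal W X Y) : f ≫ g ∈ ideal W X Z := by
  induction hf using AddSubgroup.closure_induction with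
  | mem f hf =>
    obtain ⟨Q, hQ, i, p, rfl⟩ := hf
    exact AddSubgroup.subset_closure ⟨Q, hQ, i, p ≫ g, by simp⟩
  | zero => simp
  | add f h _ _ hf hh => simpa using add_mem hf hh
  | neg f _ hf => simpa using hf

/-- Two parallel morphisms are identified in `B/W` when their difference is in the ideal `[W]`. -/
def idealRel (W : ObjectProperty B) : HomRel B :=
  fun X Y f g => f - g ∈ ideal W X Y

instance (W : ObjectProperty B) : Congruence (idealRel W) where
  equivalence :=
    { refl := fun f => by simp [idealRel]
      symm := fun {f g} h => by
        have h' := neg_mem h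
        rwa [neg_sub] at h'
      trans := fun {f g k} h h' => by
        have h'' := add_mem h h'
        rwa [sub_add_sub_cancel] at h'' }
  comp_left := fun {_ _ _} f {g g'} h => by
    have h' := comp_mem_ideal W f h
    rwa [Preadditive.comp_sub] at h'
  comp_right := fun {_ _ _} {f f'} g h => by
    have h' := mem_ideal_comp W g h
    rwa [Preadditive.sub_comp] at h'

/-- The quotient category `B/W`. -/
abbrev AddQuotient (W : ObjectProperty B) := Quotient (idealRel W)

instance (W : ObjectProperty B) : Preadditive (AddQuotient W) :=
  Quotient.preadditive _ (fun X Y f₁ f₂ g₁ g₂ hf hg => by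
    have h := add_mem hf hg
    rwa [← add_sub_add_comm] at h)

/-- The full subcategory `S/W` of `B/W` on the objects of `S`. -/
abbrev SubQuotient (S W : ObjectProperty B) :=
  ObjectProperty.FullSubcategory (fun X : AddQuotient W => S X.as)

end AdditiveQuotient

/-! ### Coherent functors -/

/-- A contravariant additive functor `F` from `A` to abelian groups is coherent if there is an
exact sequence `A(-, X) ⟶ A(-, Y) ⟶ F ⟶ 0` (exactness is objectwise). -/
def isCoherent (A : Type u) [Category.{v} A] [Preadditive A] :
    ObjectProperty (Aᵒᵖ ⥤ AddCommGrpCat.{v}) :=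
  fun F => F.Additive ∧ ∃ (X Y : A) (f : X ⟶ Y) (π : preadditiveYoneda.obj Y ⟶ F),
    ∀ Z : Aᵒᵖ, Function.Exact ((preadditiveYoneda.map f).app Z) (π.app Z) ∧
      Function.Surjective (π.app Z)

/-- The category `mod A` of coherent functors on `A`, with all natural transformations. -/
abbrev Mod (A : Type u) [Category.{v} A] [Preadditive A] := (isCoherent A).FullSubcategory

/-! ### Extriangulated categories -/

section Sequences

variable {B : Type u} [Category.{v} B]

/-- A sequence `A ⟶ mid ⟶ C` with fixed ends. -/
structure Seq (A C : B) where
  /-- the middle term -/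
  mid : B
  /-- the first morphism -/
  x : A ⟶ mid
  /-- the second morphism -/
  y : mid ⟶ C

/-- Equivalence of sequences: an isomorphism of the middle terms which is compatible with the
morphisms from and to the fixed ends. -/
instance Seq.setoid (A C : B) : Setoid (Seq A C) where
  r S S' := ∃ b : S.mid ≅ S'.mid, S.x ≫ b.hom = S'.x ∧ b.hom ≫ S'.y = S.y
  iseqv :=
    { refl := fun S => ⟨Iso.refl _, by simp, by simp⟩
      symm := by
        rintro S S' ⟨b, h₁, h₂⟩
        exact ⟨b.symm, by simp [← h₁], by simp [← h₂]⟩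
      trans := by
        rintro S S' S'' ⟨b, h₁, h₂⟩ ⟨b', h₁', h₂'⟩
        exact ⟨b ≪≫ b', by simp [← h₁', ← h₁], by simp [← h₂, ← h₂']⟩ }

end Sequences

section Extensions

variable {B : Type u} [Category.{v} B] (E : Bᵒᵖ ⥤ B ⥤ AddCommGrpCat.{w})

/-- The group `𝔼(C, A)` of extensions. -/
abbrev Ext (C A : B) : Type w := (E.obj (op C)).obj A

variable {E}

/-- `a_* δ` -/
def push {A A' C : B} (a : A ⟶ A') (δ : Ext E C A) : Ext E C A' :=
  (E.obj (op C)).map a δ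

/-- `c^* δ` -/
def pull {A C C' : B} (c : C' ⟶ C) (δ : Ext E C A) : Ext E C' A :=
  (E.map c.op).app A δ

/-- The direct sum `δ ⊕ δ'` of extensions, which corresponds to `(δ, 0, 0, δ')` in
`𝔼(C ⊞ C', A ⊞ A') ≅ 𝔼(C, A) ⊕ 𝔼(C, A') ⊕ 𝔼(C', A) ⊕ 𝔼(C', A')`. -/
def dsum [Preadditive B] [HasBinaryBiproducts B] {A A' C C' : B}
    (δ : Ext E C A) (δ' : Ext E C' A') : Ext E (C ⊞ C') (A ⊞ A') :=
  push biprod.inl (pull biprod.fst δ) + push biprod.inr (pull biprod.snd δ')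

end Extensions

variable (B : Type u) [Category.{v} B] [Preadditive B] [HasBinaryBiproducts B]

/-- The structure `(𝔼, 𝔰)` of an extriangulated category on the additive category `B`, where `𝔼`
is an additive bifunctor and `𝔰` assigns to an extension the equivalence class of the sequences
which realize it. -/
structure Extriangulation where
  /-- the bifunctor of extensions -/
  E : Bᵒᵖ ⥤ B ⥤ AddCommGrpCat.{w}
  /-- (ET1) -/
  additive_left : E.Additive
  additive_right : ∀ X : Bᵒᵖ, (E.obj X).Additive
  /-- the realization -/
  s : ∀ {A C : B}, Ext E C A → _root_.Quotient (Seq.setoid A C)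
  /-- (ET2) `𝔰` is a realization: morphisms of extensions lift to morphisms of sequences -/
  realization : ∀ {A C A' C' : B} (δ : Ext E C A) (δ' : Ext E C' A') (S : Seq A C)
    (S' : Seq A' C'), s δ = ⟦S⟧ → s δ' = ⟦S'⟧ → ∀ (a : A ⟶ A') (c : C ⟶ C'),
    push a δ = pull c δ' → ∃ b : S.mid ⟶ S'.mid, S.x ≫ b = a ≫ S'.x ∧ S.y ≫ c = b ≫ S'.y
  /-- (ET2) `𝔰` is additive -/
  s_zero : ∀ A C : B, s (0 : Ext E C A) = ⟦⟨A ⊞ C, biprod.inl, biprod.snd⟩⟧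
  s_dsum : ∀ {A C A' C' : B} (δ : Ext E C A) (δ' : Ext E C' A') (S : Seq A C) (S' : Seq A' C'),
    s δ = ⟦S⟧ → s δ' = ⟦S'⟧ →
    s (dsum δ δ') = ⟦⟨S.mid ⊞ S'.mid, biprod.map S.x S'.x, biprod.map S.y S'.y⟩⟧
  /-- (ET3) -/
  et3 : ∀ {A C A' C' : B} (δ : Ext E C A) (δ' : Ext E C' A') (S : Seq A C) (S' : Seq A' C'),
    s δ = ⟦S⟧ → s δ' = ⟦S'⟧ → ∀ (a : A ⟶ A') (b : S.mid ⟶ S'.mid), S.x ≫ b = a ≫ S'.x →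
    ∃ c : C ⟶ C', push a δ = pull c δ' ∧ S.y ≫ c = b ≫ S'.y
  /-- the dual of (ET3) -/
  et3_op : ∀ {A C A' C' : B} (δ : Ext E C A) (δ' : Ext E C' A') (S : Seq A C) (S' : Seq A' C'),
    s δ = ⟦S⟧ → s δ' = ⟦S'⟧ → ∀ (b : S.mid ⟶ S'.mid) (c : C ⟶ C'), S.y ≫ c = b ≫ S'.y →
    ∃ a : A ⟶ A', push a δ = pull c δ' ∧ S.x ≫ b = a ≫ S'.x
  /-- (ET4) -/
  et4 : ∀ {X Y Z D F : B} (δ : Ext E D X) (δ' : Ext E F Y)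
    (f : X ⟶ Y) (f' : Y ⟶ D) (g : Y ⟶ Z) (g' : Z ⟶ F), s δ = ⟦⟨Y, f, f'⟩⟧ → s δ' = ⟦⟨Z, g, g'⟩⟧ →
    ∃ (G : B) (d : D ⟶ G) (e : G ⟶ F) (h : X ⟶ Z) (h' : Z ⟶ G) (δ'' : Ext E G X),
      (f ≫ g = h ∧ f' ≫ d = g ≫ h' ∧ h' ≫ e = g') ∧ s δ'' = ⟦⟨Z, h, h'⟩⟧ ∧
      s (push f' δ') = ⟦⟨G, d, e⟩⟧ ∧ pull d δ'' = δ ∧ push f δ'' = pull e δ'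
  /-- the dual of (ET4) -/
  et4_op : ∀ {X Y Z D F : B} (δ : Ext E X D) (δ' : Ext E Y F)
    (f' : D ⟶ Y) (f : Y ⟶ X) (g' : F ⟶ Z) (g : Z ⟶ Y), s δ = ⟦⟨Y, f', f⟩⟧ → s δ' = ⟦⟨Z, g', g⟩⟧ →
    ∃ (G : B) (e : F ⟶ G) (d : G ⟶ D) (h' : G ⟶ Z) (h : Z ⟶ X) (δ'' : Ext E X G),
      (g ≫ f = h ∧ d ≫ f' = h' ≫ g ∧ e ≫ h' = g') ∧ s δ'' = ⟦⟨Z, h', h⟩⟧ ∧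
      s (pull f' δ') = ⟦⟨G, e, d⟩⟧ ∧ push d δ'' = δ ∧ pull f δ'' = push e δ'

variable {B}

/-- A full additive subcategory which is closed under isomorphisms and direct summands. -/
structure IsAdditiveThick (S : ObjectProperty B) : Prop where
  containsZero : S.ContainsZero
  isoClosed : S.IsClosedUnderIsomorphisms
  biprod : ∀ X Y : B, S X → S Y → S (X ⊞ Y)
  summand : ∀ X Y : B, S (X ⊞ Y) → S X

/-- The closure `add S` under direct summands. -/
def addClosure (S : ObjectProperty B) : ObjectProperty B :=
  fun X => ∃ Y : B, ∃ Z : B, S Z ∧ Nonempty (Z ≅ X ⊞ Y)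

namespace Extriangulation

variable (T : Extriangulation.{w} B)

/-- `X ⟶ Y ⟶ Z` is a conflation. -/
def Conflation {X Y Z : B} (x : X ⟶ Y) (y : Y ⟶ Z) : Prop :=
  ∃ δ : Ext T.E Z X, T.s δ = ⟦⟨Y, x, y⟩⟧

/-- `y` is a deflation. -/
def Deflation {Y Z : B} (y : Y ⟶ Z) : Prop :=
  ∃ (X : B) (x : X ⟶ Y), T.Conflation x y

/-- The subcategory of the projective objects: `𝔼(P, X) = 0` for all `X`. -/
def projectives : ObjectProperty B :=
  fun P => ∀ (X : B) (δ : Ext T.E P X), δ = 0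

/-- `B` has enough projectives. -/
def EnoughProjectives : Prop :=
  ∀ X : B, ∃ (P : B) (_ : T.projectives P) (y : P ⟶ X), T.Deflation y

/-- `Cone(S, S')`: the objects `X` which admit a conflation `Y ⟶ Z ⟶ X`, `Y ∈ S`, `Z ∈ S'`. -/
def cone (S S' : ObjectProperty B) : ObjectProperty B :=
  fun X => ∃ (Y Z : B) (_ : S Y) (_ : S' Z) (x : Y ⟶ Z) (y : Z ⟶ X), T.Conflation x y

/-- `CoCone(S, S')`: the objects `X` which admit a conflation `X ⟶ Y ⟶ Z`, `Y ∈ S`, `Z ∈ S'`. -/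
def cocone (S S' : ObjectProperty B) : ObjectProperty B :=
  fun X => ∃ (Y Z : B) (_ : S Y) (_ : S' Z) (x : X ⟶ Y) (y : Y ⟶ Z), T.Conflation x y

/-- `S * S'`: the objects `X` which admit a conflation `Y ⟶ X ⟶ Z`, `Y ∈ S`, `Z ∈ S'`. -/
def star (S S' : ObjectProperty B) : ObjectProperty B :=
  fun X => ∃ (Y Z : B) (_ : S Y) (_ : S' Z) (x : Y ⟶ X) (y : X ⟶ Z), T.Conflation x y

/-- `(U, V)` is a (complete) cotorsion pair. -/
structure IsCotorsionPair (U V : ObjectProperty B) : Prop where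
  left : IsAdditiveThick U
  right : IsAdditiveThick V
  ext_eq_zero : ∀ X Y : B, U X → V Y → ∀ δ : Ext T.E X Y, δ = 0
  /-- a conflation `V_X ⟶ U_X ⟶ X` -/
  exists_left : ∀ X : B, T.cone V U X
  /-- a conflation `X ⟶ V^X ⟶ U^X` -/
  exists_right : ∀ X : B, T.cocone V U X

/-- The core `W = U ∩ V`. -/
def core (U V : ObjectProperty B) : ObjectProperty B := fun X => U X ∧ V X

/-- `B⁺ = Cone(V, W)` -/
def plus (U V : ObjectProperty B) : ObjectProperty B := T.cone V (core U V)

/-- `B⁻ = CoCone(W, U)` -/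
def minus (U V : ObjectProperty B) : ObjectProperty B := T.cocone (core U V) U

/-- The heart of `(U, V)`: the full subcategory `(B⁺ ∩ B⁻)/W` of `B/W`. -/
abbrev Heart (U V : ObjectProperty B) :=
  SubQuotient (fun X => T.plus U V X ∧ T.minus U V X) (core U V)

/-- The kernel `K = add(U * V)` of `(U, V)`. -/
def kernel (U V : ObjectProperty B) : ObjectProperty B := addClosure (T.star U V)

/-- The coheart of `(U, V)`: the objects `X ∈ U` with `𝔼(X, U) = 0`. -/
def coheart (U : ObjectProperty B) : ObjectProperty B :=
  fun X => U X ∧ ∀ (Y : B), U Y → ∀ δ : Ext T.E X Y, δ = 0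

end Extriangulation

end Extri

end

/-! The equivalence sends `X` to `𝔼(-, X)` restricted to the coheart. Projectives kill extensions on
the left, and `𝔼(C, W) = 0` for `C` in the coheart and `W` in the core, so this descends to both
quotients.

Full faithfulness rests on a conflation `X ⟶ A ⟶ C` with `A` in `U` and `C` in the coheart, for each
`X` in `B⁻` (`exists_coheart_coresolution`). Its class generates `𝔼(-, X)` on the coheart, and a
morphism into `B⁺` that kills it factors through `A`, hence through the core
(`exists_universal_extension`). The hypothesis on `(C, K)` enters mainly through `syzygy_mem`.

Coherence follows from the conflations of the pair `(C, K)` (`exists_presentation`). For density, a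
morphism `f : C₁ ⟶ C₀` is completed by a projective to a deflation; its kernel `X` lies in `B⁻` and
is moved into the heart without changing `𝔼(-, X)` on the coheart (`exists_heart_of_hom`). -/

namespace Extri

/-! ### Functoriality of extensions. -/

section Functoriality

variable {B : Type u} [Category.{v} B] {E : Bᵒᵖ ⥤ B ⥤ AddCommGrpCat.{w}}

@[simp] theorem push_id {A C : B} (δ : Ext E C A) : push (𝟙 A) δ = δ := by simp [push]

@[simp] theorem pull_id {A C : B} (δ : Ext E C A) : pull (𝟙 C) δ = δ := by simp [pull]

theorem push_comp {A A' A'' C : B} (a : A ⟶ A') (a' : A' ⟶ A'') (δ : Ext E C A) :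
    push (a ≫ a') δ = push a' (push a δ) := by simp [push]

theorem pull_comp {A C C' C'' : B} (c : C' ⟶ C) (c' : C'' ⟶ C') (δ : Ext E C A) :
    pull (c' ≫ c) δ = pull c' (pull c δ) := by simp [pull]

theorem push_pull {A A' C C' : B} (a : A ⟶ A') (c : C' ⟶ C) (δ : Ext E C A) :
    push a (pull c δ) = pull c (push a δ) :=
  (ConcreteCategory.congr_hom ((E.map c.op).naturality a) δ).symm

theorem push_add_right {A A' C : B} (a : A ⟶ A') (δ δ' : Ext E C A) :
    push a (δ + δ') = push a δ + push a δ' := map_add _ _ _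

@[simp] theorem push_zero_right {A A' C : B} (a : A ⟶ A') : push a (0 : Ext E C A) = 0 :=
  map_zero _

@[simp] theorem pull_zero_right {A C C' : B} (c : C' ⟶ C) : pull c (0 : Ext E C A) = 0 :=
  map_zero _

end Functoriality

namespace Extriangulation

variable {B : Type u} [Category.{v} B] [Preadditive B] [HasBinaryBiproducts B]
  (T : Extriangulation.{w} B)

theorem push_add {A A' C : B} (a a' : A ⟶ A') (δ : Ext T.E C A) :
    push (a + a') δ = push a δ + push a' δ := by
  have := T.additive_right (op C)
  simp [push, Functor.map_add]

theorem pull_add {A C C' : B} (c c' : C' ⟶ C) (δ : Ext T.E C A) :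
    pull (c + c') δ = pull c δ + pull c' δ := by
  have := T.additive_left
  simp [pull, Functor.map_add]

theorem push_zero {A A' C : B} (δ : Ext T.E C A) : push (0 : A ⟶ A') δ = 0 := by
  simpa using T.push_add (0 : A ⟶ A') 0 δ

theorem pull_zero {A C C' : B} (δ : Ext T.E C A) : pull (0 : C' ⟶ C) δ = 0 := by
  simpa using T.pull_add (0 : C' ⟶ C) 0 δ

theorem push_sub {A A' C : B} (a a' : A ⟶ A') (δ : Ext T.E C A) :
    push (a - a') δ = push a δ - push a' δ := by
  rw [eq_sub_iff_add_eq, ← push_add, sub_add_cancel]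

theorem pull_sub {A C C' : B} (c c' : C' ⟶ C) (δ : Ext T.E C A) :
    pull (c - c') δ = pull c δ - pull c' δ := by
  rw [eq_sub_iff_add_eq, ← pull_add, sub_add_cancel]

theorem exists_realization {A C : B} (δ : Ext T.E C A) :
    ∃ (Y : B) (x : A ⟶ Y) (y : Y ⟶ C), T.s δ = ⟦⟨Y, x, y⟩⟧ := by
  obtain ⟨⟨Y, x, y⟩, h⟩ := Quotient.exists_rep (T.s δ)
  exact ⟨Y, x, y, h.symm⟩

/-! ### Exact sequences attached to a conflation. -/

section LongExact

variable {T} {A Y C : B} {δ : Ext T.E C A} {x : A ⟶ Y} {y : Y ⟶ C}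

theorem comp_eq_zero_of_s_eq (h : T.s δ = ⟦⟨Y, x, y⟩⟧) : x ≫ y = 0 := by
  obtain ⟨c, -, hc⟩ := T.et3 0 δ _ _ (T.s_zero A A) h (𝟙 A) (biprod.desc x 0) (by simp)
  simpa using (biprod.inl ≫= hc).symm

theorem pull_deflation_eq_zero (h : T.s δ = ⟦⟨Y, x, y⟩⟧) : pull y δ = 0 := by
  obtain ⟨a, ha, -⟩ := T.et3_op 0 δ _ _ (T.s_zero A Y) h (biprod.desc x (𝟙 Y)) y
    (by ext <;> simp [comp_eq_zero_of_s_eq h])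
  simpa using ha.symm

theorem push_inflation_eq_zero (h : T.s δ = ⟦⟨Y, x, y⟩⟧) : push x δ = 0 := by
  obtain ⟨c, hc, -⟩ := T.et3 δ 0 _ _ h (T.s_zero Y C) x (biprod.lift (𝟙 Y) y)
    (by ext <;> simp [comp_eq_zero_of_s_eq h])
  simpa using hc

theorem pull_eq_zero_iff (h : T.s δ = ⟦⟨Y, x, y⟩⟧) {Z : B} (f : Z ⟶ C) :
    pull f δ = 0 ↔ ∃ g : Z ⟶ Y, g ≫ y = f := by
  constructor
  · intro hf
    obtain ⟨b, -, hb⟩ := T.realization 0 δ _ _ (T.s_zero A Z) h (𝟙 A) f (by simp [hf])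
    exact ⟨biprod.inr ≫ b, by simpa using (biprod.inr ≫= hb).symm⟩
  · rintro ⟨g, rfl⟩
    rw [pull_comp, pull_deflation_eq_zero h, pull_zero_right]

theorem push_eq_zero_iff (h : T.s δ = ⟦⟨Y, x, y⟩⟧) {Z : B} (f : A ⟶ Z) :
    push f δ = 0 ↔ ∃ g : Y ⟶ Z, x ≫ g = f := by
  constructor
  · intro hf
    obtain ⟨b, hb, -⟩ := T.realization δ 0 _ _ h (T.s_zero Z C) f (𝟙 C) (by simp [hf])
    exact ⟨b ≫ biprod.fst, by simpa using hb =≫ biprod.fst⟩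
  · rintro ⟨g, rfl⟩
    rw [push_comp, push_inflation_eq_zero h, push_zero_right]

theorem exists_pull_eq (h : T.s δ = ⟦⟨Y, x, y⟩⟧) {Z : B} (ξ : Ext T.E Z A) (hξ : push x ξ = 0) :
    ∃ f : Z ⟶ C, pull f δ = ξ := by
  obtain ⟨M, i, p, hM⟩ := T.exists_realization ξ
  obtain ⟨b, hb⟩ := (push_eq_zero_iff hM x).1 hξ
  obtain ⟨c, hc, -⟩ := T.et3 ξ δ _ _ hM h (𝟙 A) b (by simp [hb])
  exact ⟨c, by simpa using hc.symm⟩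

theorem exists_push_eq (h : T.s δ = ⟦⟨Y, x, y⟩⟧) {Z : B} (ξ : Ext T.E C Z) (hξ : pull y ξ = 0) :
    ∃ f : A ⟶ Z, push f δ = ξ := by
  obtain ⟨M, i, p, hM⟩ := T.exists_realization ξ
  obtain ⟨b, hb⟩ := (pull_eq_zero_iff hM y).1 hξ
  obtain ⟨a, ha, -⟩ := T.et3_op δ ξ _ _ h hM b (𝟙 C) (by simp [hb])
  exact ⟨a, by simpa using ha⟩

/-- (ET4) gives a conflation `C ⟶ G ⟶ Z` realizing `y_* ξ = 0`, and a class on `G` whose push along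
`x` is the pullback of `ξ`. Restricting this class along a section of `G ⟶ Z` gives the preimage. -/
theorem exists_push_inflation_eq (h : T.s δ = ⟦⟨Y, x, y⟩⟧) {Z : B} (ξ : Ext T.E Z Y)
    (hξ : push y ξ = 0) : ∃ ξ' : Ext T.E Z A, push x ξ' = ξ := by
  obtain ⟨M, i, p, hM⟩ := T.exists_realization ξ
  obtain ⟨G, d, e, -, -, δ'', -, -, hG, -, hδ⟩ := T.et4 δ ξ x y i p h hM
  obtain ⟨t, ht⟩ := (pull_eq_zero_iff hG (𝟙 Z)).1 (by simp [hξ])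
  exact ⟨pull t δ'', by rw [push_pull, hδ, ← pull_comp, ht, pull_id]⟩

theorem exists_pull_deflation_eq (h : T.s δ = ⟦⟨Y, x, y⟩⟧) {Z : B} (ξ : Ext T.E Y Z)
    (hξ : pull x ξ = 0) : ∃ ξ' : Ext T.E C Z, pull y ξ' = ξ := by
  obtain ⟨M, i, p, hM⟩ := T.exists_realization ξ
  obtain ⟨G, e, d, -, -, δ'', -, -, hG, -, hδ⟩ := T.et4_op δ ξ x y i p h hM
  obtain ⟨t, ht⟩ := (push_eq_zero_iff hG (𝟙 Z)).1 (by simp [hξ])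
  exact ⟨push t δ'', by rw [← push_pull, hδ, ← push_comp, ht, push_id]⟩

/-- A class of the form `⊥V` is closed under extensions. -/
theorem ext_source_eq_zero (h : T.s δ = ⟦⟨Y, x, y⟩⟧) {Z : B} (hA : ∀ ξ : Ext T.E A Z, ξ = 0)
    (hC : ∀ ξ : Ext T.E C Z, ξ = 0) (ξ : Ext T.E Y Z) : ξ = 0 := by
  obtain ⟨ξ', rfl⟩ := exists_pull_deflation_eq h ξ (hA _)
  rw [hC ξ', pull_zero_right]

end LongExact

/-- If `p` is a deflation, then so is `(f, p)`, up to a summand which is mapped to zero. -/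
theorem exists_conflation_desc {C₁ C₀ P : B} (f : C₁ ⟶ C₀) {p : P ⟶ C₀} (hp : T.Deflation p) :
    ∃ (X : B) (i : X ⟶ (C₁ ⊞ C₁) ⊞ P),
      T.Conflation i (biprod.desc (biprod.snd ≫ f) p) := by
  obtain ⟨D, j, δ, hδ⟩ := hp
  -- This shear turns the split conflation into one with deflation `(f, 1)`.
  let b : C₁ ⊞ C₀ ≅ C₁ ⊞ C₀ :=
    { hom := biprod.desc (biprod.lift (𝟙 _) (-f)) biprod.inr
      inv := biprod.desc (biprod.lift (𝟙 _) f) biprod.inr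
      hom_inv_id := by ext <;> simp
      inv_hom_id := by ext <;> simp }
  have h₁ : T.s (0 : Ext T.E C₀ C₁) =
      ⟦⟨C₁ ⊞ C₀, biprod.lift (𝟙 _) (-f), biprod.desc f (𝟙 _)⟩⟧ :=
    (T.s_zero C₁ C₀).trans
      (Quotient.sound ⟨b, by simp [b], by dsimp [b]; ext <;> simp⟩)
  -- The split conflation `C₁ ⟶ C₁ ⊞ C₁ ⟶ C₁` plays the role of the identity of `C₁`; this is the
  -- origin of the first, idle copy of `C₁`.
  have h₂ := T.s_dsum 0 δ _ _ (T.s_zero C₁ C₁) hδ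
  obtain ⟨X, -, -, i, q, ε, ⟨hq, -, -⟩, h, -⟩ := T.et4_op _ _ _ _ _ _ h₁ h₂
  refine ⟨X, i, ε, ?_⟩
  have : q = biprod.desc (biprod.snd ≫ f) p := by
    rw [← hq]
    ext <;> simp
  rw [h, this]

end Extriangulation

end Extri

/-! ### Cotorsion pairs, syzygies and coresolutions. -/

namespace Extri

namespace Extriangulation

variable {B : Type u} [Category.{v} B] [Preadditive B] [HasBinaryBiproducts B]
  {T : Extriangulation.{w} B}

theorem nonempty_iso_of_s_eq {A Y Y' C : B} {δ : Ext T.E C A} {x : A ⟶ Y} {y : Y ⟶ C}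
    {x' : A ⟶ Y'} {y' : Y' ⟶ C} (h : T.s δ = ⟦⟨Y, x, y⟩⟧) (h' : T.s δ = ⟦⟨Y', x', y'⟩⟧) :
    Nonempty (Y ≅ Y') := by
  obtain ⟨b, -, -⟩ := Quotient.exact (h.symm.trans h')
  exact ⟨b⟩

theorem s_zero_swap (T : Extriangulation.{w} B) (A C : B) :
    T.s (0 : Ext T.E A C) = ⟦⟨A ⊞ C, biprod.inr, biprod.fst⟩⟧ :=
  (T.s_zero C A).trans (Quotient.sound ⟨biprod.braiding C A, by dsimp; ext <;> simp, by simp⟩)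

theorem exists_conflation_of_push_eq {A A₁ A₂ M B₂ C : B} {p : A₁ ⟶ A} {q : A ⟶ A₂}
    (hpq : T.s (0 : Ext T.E A₂ A₁) = ⟦⟨A, p, q⟩⟧) {μ : Ext T.E C A} {i : A ⟶ M} {j : M ⟶ C}
    (hμ : T.s μ = ⟦⟨M, i, j⟩⟧) {x : A₂ ⟶ B₂} {y : B₂ ⟶ C} (h : T.s (push q μ) = ⟦⟨B₂, x, y⟩⟧) :
    ∃ (G : B) (x' : A₁ ⟶ M) (y' : M ⟶ G), T.Conflation x' y' ∧ Nonempty (B₂ ≅ G) := by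
  obtain ⟨G, d, e, x', y', ε, -, hε, hG, -⟩ := T.et4 _ _ _ _ _ _ hpq hμ
  exact ⟨G, x', y', ⟨ε, hε⟩, nonempty_iso_of_s_eq h hG⟩

/-- Two conflations with the same cokernel have a common pullback. -/
theorem exists_common_pullback {A₁ A₂ B₁ B₂ C : B} {x₁ : A₁ ⟶ B₁} {y₁ : B₁ ⟶ C} {x₂ : A₂ ⟶ B₂}
    {y₂ : B₂ ⟶ C} (h₁ : T.Conflation x₁ y₁) (h₂ : T.Conflation x₂ y₂) :
    ∃ M : B, (∃ (G : B) (x : A₁ ⟶ M) (y : M ⟶ G), T.Conflation x y ∧ Nonempty (B₂ ≅ G)) ∧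
      ∃ (G : B) (x : A₂ ⟶ M) (y : M ⟶ G), T.Conflation x y ∧ Nonempty (B₁ ≅ G) := by
  obtain ⟨δ₁, h₁⟩ := h₁
  obtain ⟨δ₂, h₂⟩ := h₂
  -- The projections of `A₁ ⊞ A₂` push this class to `δ₁` and `δ₂`, so dividing `M` by one summand
  -- leaves the middle term of the other conflation.
  obtain ⟨M, i, j, hM⟩ :=
    T.exists_realization (push (biprod.inl : A₁ ⟶ A₁ ⊞ A₂) δ₁ + push biprod.inr δ₂)
  refine ⟨M, exists_conflation_of_push_eq (T.s_zero A₁ A₂) hM (x := x₂) (y := y₂) ?_,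
    exists_conflation_of_push_eq (T.s_zero_swap A₁ A₂) hM (x := x₁) (y := y₁) ?_⟩
  · rw [push_add_right, ← push_comp, ← push_comp]
    simpa [push_zero] using h₂
  · rw [push_add_right, ← push_comp, ← push_comp]
    simpa [push_zero] using h₁

/-- If all extensions of `X` by `V` vanish, the conflation `V_X ⟶ U_X ⟶ X` splits and `X` is a
summand of `U_X`. -/
theorem IsCotorsionPair.mem_left_iff {U V : ObjectProperty B} (h : T.IsCotorsionPair U V) {X : B} :
    U X ↔ ∀ Y : B, V Y → ∀ δ : Ext T.E X Y, δ = 0 := by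
  refine ⟨fun hX Y hY => h.ext_eq_zero X Y hX hY, fun hX => ?_⟩
  obtain ⟨A, Z, hA, hZ, x, y, δ, hδ⟩ := h.exists_left X
  obtain rfl := hX A hA δ
  obtain ⟨e⟩ := nonempty_iso_of_s_eq hδ (T.s_zero_swap X A)
  have := h.left.isoClosed
  exact h.left.summand X A (U.prop_of_iso e hZ)

theorem IsCotorsionPair.mem_left_of_conflation {U V : ObjectProperty B}
    (h : T.IsCotorsionPair U V) {X Y Z : B} {x : X ⟶ Y} {y : Y ⟶ Z} (hxy : T.Conflation x y)
    (hX : U X) (hZ : U Z) : U Y := by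
  obtain ⟨δ, hδ⟩ := hxy
  exact h.mem_left_iff.2 fun _ hV => ext_source_eq_zero hδ (h.ext_eq_zero _ _ hX hV)
    (h.ext_eq_zero _ _ hZ hV)

theorem IsCotorsionPair.projectives_le {U V : ObjectProperty B} (h : T.IsCotorsionPair U V) :
    T.projectives ≤ U :=
  fun _ hP => h.mem_left_iff.2 fun Y _ => hP Y

variable {U V : ObjectProperty B}

/-- A morphism from an object of `U` to an object of `B⁺` factors through the core. -/
theorem IsCotorsionPair.exists_factorization (hUV : T.IsCotorsionPair U V) {A Y : B} (hA : U A)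
    (hY : T.plus U V Y) (f : A ⟶ Y) :
    ∃ (Z : B) (_ : core U V Z) (i : A ⟶ Z) (p : Z ⟶ Y), i ≫ p = f := by
  obtain ⟨V₀, W₀, hV, hW, x, y, δ, hδ⟩ := hY
  obtain ⟨i, hi⟩ := (pull_eq_zero_iff hδ f).1 (hUV.ext_eq_zero _ _ hA hV _)
  exact ⟨W₀, hW, i, y, hi⟩

/-- Embed the middle term `M` in `V₀` with cokernel in `U`. Then `V₀` is in the core, and the
cokernel of `X ⟶ M ⟶ V₀` is an extension of objects of `U`. -/
theorem IsCotorsionPair.minus_of_cocone (hUV : T.IsCotorsionPair U V) {X : B}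
    (hX : T.cocone U U X) : T.minus U V X := by
  obtain ⟨M, C, hM, hC, x, y, δ, hδ⟩ := hX
  obtain ⟨V₀, U₀, hV, hU, i, p, ε, hε⟩ := hUV.exists_right M
  obtain ⟨G, d, e, h, h', δ'', -, h₁, h₂, -⟩ := T.et4 _ _ _ _ _ _ hδ hε
  exact ⟨V₀, G, ⟨hUV.mem_left_of_conflation ⟨ε, hε⟩ hM hU, hV⟩,
    hUV.mem_left_of_conflation ⟨_, h₂⟩ hC hU, h, h', δ'', h₁⟩

/-- The objects of `B⁻` are stable under the extensions by the objects of `U`. -/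
theorem IsCotorsionPair.minus_of_conflation (hUV : T.IsCotorsionPair U V) {X G A : B} {x : X ⟶ G}
    {y : G ⟶ A} (hxy : T.Conflation x y) (hX : T.minus U V X) (hA : U A) : T.minus U V G := by
  obtain ⟨δ, hδ⟩ := hxy
  obtain ⟨V', U', hV', hU', i, p, ε, hε⟩ := hUV.exists_right G
  obtain ⟨Q, d, e, h, h', δ'', -, hQ, hdQ, -⟩ := T.et4 _ _ _ _ _ _ hδ hε
  obtain ⟨W₀, U₀, hW, hU, j, q, θ, hθ⟩ := hX
  obtain ⟨t, rfl⟩ := (push_eq_zero_iff hθ h).1 (hUV.ext_eq_zero _ _ hU hV' _)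
  -- Only `V' ∈ U` is missing. A class on `V'` dies on `X`, as `X ⟶ V'` factors through `W₀`; so it
  -- comes from `Q`, an extension of `U'` by `A`, hence in `U`.
  refine ⟨V', U', ⟨hUV.mem_left_iff.2 fun V₀ hV₀ ξ => ?_, hV'⟩, hU', i, p, ε, hε⟩
  obtain ⟨ξ', rfl⟩ := exists_pull_deflation_eq hQ ξ (by
    rw [pull_comp, hUV.ext_eq_zero _ _ hW.1 hV₀ (pull t ξ), pull_zero_right])
  rw [hUV.ext_eq_zero _ _ (hUV.mem_left_of_conflation ⟨_, hdQ⟩ hA hU') hV₀ ξ', pull_zero_right]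

/-- Every object `X` has a conflation `X ⟶ X⁺ ⟶ A` with `X⁺` in `B⁺` and `A` in `U`, where
`X⁺ ⟶ A` is a factor of a morphism which is a deflation with kernel in `U`. -/
theorem IsCotorsionPair.exists_plus (hUV : T.IsCotorsionPair U V) (X : B) :
    ∃ (G A : B) (d : X ⟶ G) (e : G ⟶ A), T.Conflation d e ∧ T.plus U V G ∧ U A ∧
      ∃ (K W₀ : B) (_ : U K) (i : K ⟶ W₀) (p : W₀ ⟶ A) (h : W₀ ⟶ G), T.Conflation i p ∧
        h ≫ e = p := by
  obtain ⟨V₁, U₁, hV₁, hU₁, x, y, δ, hδ⟩ := hUV.exists_left X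
  obtain ⟨V₂, U₂, hV₂, hU₂, i, p, ε, hε⟩ := hUV.exists_right U₁
  -- `G` is the cokernel of `V₁ ⟶ U₁ ⟶ V₂`, where `V₂` is in the core as an extension of `U₂` by
  -- `U₁`.
  obtain ⟨G, d, e, h, h', δ'', ⟨-, -, hp⟩, h₁, h₂, -⟩ := T.et4 _ _ _ _ _ _ hδ hε
  exact ⟨G, U₂, d, e, ⟨_, h₂⟩,
    ⟨V₁, V₂, hV₁, ⟨hUV.mem_left_of_conflation ⟨ε, hε⟩ hU₁ hU₂, hV₂⟩, h, h', δ'', h₁⟩, hU₂,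
    U₁, V₂, hU₁, i, p, h', ⟨ε, hε⟩, hp⟩

/-- The syzygy of an object of `U` with respect to the cotorsion pair of the coheart and the
kernel is in `U`. -/
theorem IsCotorsionPair.syzygy_mem (hUV : T.IsCotorsionPair U V) {K C A : B} {x : K ⟶ C}
    {y : C ⟶ A} (hxy : T.Conflation x y) (hK : T.kernel U V K) (hC : T.coheart U C) (hA : U A) :
    U K := by
  obtain ⟨κ, hκ⟩ := hxy
  obtain ⟨Y, Z, ⟨U₁, V₁, hU₁, hV₁, a, b, θ, hθ⟩, ⟨e⟩⟩ := hK
  -- As `𝔼(A, V₁) = 0` and `𝔼(C, U₁) = 0`, the image of `κ` in the extensions by `Z` comes from some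
  -- `r : K ⟶ U₁`. Then `𝟙 K` minus the resulting endomorphism kills `κ`, so it factors through `C`.
  obtain ⟨κ', hκ'⟩ := exists_push_inflation_eq hθ (push (biprod.inl ≫ e.inv) κ)
    (hUV.ext_eq_zero _ _ hA hV₁ _)
  obtain ⟨r, hr⟩ := exists_push_eq hκ κ' (hC.2 _ hU₁ _)
  obtain ⟨s, hs⟩ := (push_eq_zero_iff hκ (𝟙 K - r ≫ a ≫ e.hom ≫ biprod.fst)).1 (by
    rw [push_sub, push_id, push_comp, push_comp, hr, hκ', ← push_comp]
    simp)
  -- The identity of `K` is now a sum of morphisms through `C` and `U₁`, both in `U`.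
  refine hUV.mem_left_iff.2 fun V₀ hV₀ ξ => ?_
  have h : x ≫ s + r ≫ a ≫ e.hom ≫ biprod.fst = 𝟙 K := by rw [hs, sub_add_cancel]
  rw [← pull_id ξ, ← h, T.pull_add, pull_comp, pull_comp,
    hUV.ext_eq_zero _ _ hC.1 hV₀ (pull s ξ), hUV.ext_eq_zero _ _ hU₁ hV₀ (pull _ ξ),
    pull_zero_right, pull_zero_right, add_zero]

/-- Every object of `B⁻` has a conflation `X ⟶ A ⟶ C` with `A` in `U` and `C` in the coheart. -/
theorem IsCotorsionPair.exists_coheart_coresolution (hUV : T.IsCotorsionPair U V)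
    (hCK : T.IsCotorsionPair (T.coheart U) (T.kernel U V)) {X : B} (hX : T.minus U V X) :
    T.cocone U (T.coheart U) X := by
  obtain ⟨W₀, U₀, hW, hU, x, y, hxy⟩ := hX
  obtain ⟨K, C, hK, hC, x', y', hxy'⟩ := hCK.exists_left U₀
  obtain ⟨M, ⟨G, i, p, hip, ⟨e⟩⟩, ⟨G', i', p', hip', ⟨e'⟩⟩⟩ := exists_common_pullback hxy hxy'
  have := hUV.left.isoClosed
  have := hCK.left.isoClosed
  exact ⟨M, G, hUV.mem_left_of_conflation hip' (hUV.syzygy_mem hxy' hK hC hU)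
    (U.prop_of_iso e' hW.1), ObjectProperty.prop_of_iso _ e hC, i, p, hip⟩

/-- An extension of an object of `U` by an object of `B⁺` vanishes if its restrictions to the
coheart do. -/
theorem IsCotorsionPair.ext_eq_zero_of_pull_coheart (hUV : T.IsCotorsionPair U V)
    (hCK : T.IsCotorsionPair (T.coheart U) (T.kernel U V)) {A Y : B} (hA : U A)
    (hY : T.plus U V Y) (ε : Ext T.E A Y)
    (hε : ∀ (C : B) (_ : T.coheart U C) (c : C ⟶ A), pull c ε = 0) : ε = 0 := by
  -- A class that dies on `C` is pushed from `κ` along some `K ⟶ Y`. As `K` is in `U`, this morphism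
  -- factors through the core, and `𝔼(A, V) = 0`.
  obtain ⟨K, C, hK, hC, x, y, κ, hκ⟩ := hCK.exists_left A
  obtain ⟨f, rfl⟩ := exists_push_eq hκ ε (hε C hC y)
  obtain ⟨Z, hZ, i, p, rfl⟩ :=
    hUV.exists_factorization (hUV.syzygy_mem ⟨κ, hκ⟩ hK hC hA) hY f
  rw [push_comp, hUV.ext_eq_zero _ _ hA hZ.2 (push i κ), push_zero_right]

/-- An object of `B⁻` has an extension which is universal among its extensions by the objects of
the coheart. -/
theorem IsCotorsionPair.exists_universal_extension (hUV : T.IsCotorsionPair U V)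
    (hCK : T.IsCotorsionPair (T.coheart U) (T.kernel U V)) {X : B} (hX : T.minus U V X) :
    ∃ (C : B) (_ : T.coheart U C) (δ : Ext T.E C X),
      (∀ (C' : B) (_ : T.coheart U C') (ξ : Ext T.E C' X), ∃ c : C' ⟶ C, pull c δ = ξ) ∧
      (∀ (Y : B) (_ : T.plus U V Y) (ε : Ext T.E C Y),
        (∀ (C' : B) (_ : T.coheart U C') (c : C' ⟶ C), pull c δ = 0 → pull c ε = 0) →
        ∃ f : X ⟶ Y, push f δ = ε) ∧
      ∀ (Y : B) (_ : T.plus U V Y) (f : X ⟶ Y), push f δ = 0 → FactorsThru (core U V) f := by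
  obtain ⟨A, C, hA, hC, x, y, δ, hδ⟩ := hUV.exists_coheart_coresolution hCK hX
  refine ⟨C, hC, δ, fun C' hC' ξ => exists_pull_eq hδ ξ (hC'.2 _ hA _), fun Y hY ε hε => ?_,
    fun Y hY f hf => ?_⟩
  · refine exists_push_eq hδ ε (hUV.ext_eq_zero_of_pull_coheart hCK hA hY _ fun C' hC' c => ?_)
    -- A morphism to `C` through `A` pulls `δ` back to zero, so the hypothesis on `ε` applies to it.
    rw [← pull_comp]
    exact hε C' hC' _ ((pull_eq_zero_iff hδ _).2 ⟨c, rfl⟩)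
  · obtain ⟨g, rfl⟩ := (push_eq_zero_iff hδ f).1 hf
    obtain ⟨Z, hZ, i, p, rfl⟩ := hUV.exists_factorization hA hY g
    exact ⟨Z, hZ, x ≫ i, p, by simp⟩

/-! ### Presentations of extension functors on the coheart. -/

theorem pull_eq_zero_of_mem_ideal {C C' : B} {c : C ⟶ C'} (hc : c ∈ ideal T.projectives C C')
    {X : B} (δ : Ext T.E C' X) : pull c δ = 0 := by
  induction hc using AddSubgroup.closure_induction with
  | mem c hc =>
    obtain ⟨P, hP, i, p, rfl⟩ := hc
    rw [pull_comp, hP X (pull p δ), pull_zero_right]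
  | zero => exact T.pull_zero δ
  | add c c' _ _ hc hc' => rw [T.pull_add, hc, hc', add_zero]
  | neg c _ hc => rw [← zero_sub, T.pull_sub, hc, T.pull_zero, sub_zero]

theorem push_eq_zero_of_mem_ideal {W : ObjectProperty B} {X Y : B} {f : X ⟶ Y}
    (hf : f ∈ ideal W X Y) {C : B} (hC : ∀ Z, W Z → ∀ ξ : Ext T.E C Z, ξ = 0)
    (δ : Ext T.E C X) : push f δ = 0 := by
  induction hf using AddSubgroup.closure_induction with
  | mem f hf =>
    obtain ⟨Z, hZ, i, p, rfl⟩ := hf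
    rw [push_comp, hC Z hZ (push i δ), push_zero_right]
  | zero => exact T.push_zero δ
  | add f f' _ _ hf hf' => rw [T.push_add, hf, hf', add_zero]
  | neg f _ hf => rw [← zero_sub, T.push_sub, hf, T.push_zero, sub_zero]

variable (T) in
/-- The morphism `f` and the extension `δ` present the functor `𝔼(-, X)` on `S`, modulo projective
objects. -/
def Presents (S : ObjectProperty B) {C₁ C₀ X : B} (f : C₁ ⟶ C₀) (δ : Ext T.E C₀ X) : Prop :=
  ∀ C : B, S C → (∀ ξ : Ext T.E C X, ∃ c : C ⟶ C₀, pull c δ = ξ) ∧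
    ∀ c : C ⟶ C₀, pull c δ = 0 ↔ ∃ g : C ⟶ C₁, c - g ≫ f ∈ ideal T.projectives C C₀

/-- The restrictions to the coheart of the extensions by any object have a presentation by
objects of the coheart. -/
theorem IsCotorsionPair.exists_presentation
    (hCK : T.IsCotorsionPair (T.coheart U) (T.kernel U V)) (X : B) :
    ∃ (C₁ C₀ : B) (_ : T.coheart U C₁) (_ : T.coheart U C₀) (f : C₁ ⟶ C₀) (δ : Ext T.E C₀ X),
      T.Presents (T.coheart U) f δ := by
  obtain ⟨K, C₀, hK, hC₀, x, y, δ, hδ⟩ := hCK.exists_right X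
  obtain ⟨K', C₁, hK', hC₁, x', y', δ', hδ'⟩ := hCK.exists_left K
  -- Since `𝔼(C, K) = 𝔼(C, K') = 0` for `C` in the coheart, every class is pulled back from `δ`, and
  -- a morphism killing `δ` lifts first to `K`, then to `C₁`.
  refine ⟨C₁, C₀, hC₁, hC₀, y' ≫ y, δ, fun C hC => ⟨fun ξ => exists_pull_eq hδ ξ
    (hCK.ext_eq_zero _ _ hC hK _), fun c => ⟨fun hc => ?_, ?_⟩⟩⟩
  · obtain ⟨g, rfl⟩ := (pull_eq_zero_iff hδ c).1 hc
    obtain ⟨g, rfl⟩ := (pull_eq_zero_iff hδ' g).1 (hCK.ext_eq_zero _ _ hC hK' _)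
    exact ⟨g, by simp⟩
  · rintro ⟨g, hg⟩
    rw [← sub_add_cancel c (g ≫ y' ≫ y), T.pull_add, pull_eq_zero_of_mem_ideal hg, zero_add]
    exact (pull_eq_zero_iff hδ _).2 ⟨g ≫ y', by simp⟩

/-- Every morphism of the coheart presents the extensions by an object of the heart. -/
theorem IsCotorsionPair.exists_heart_of_hom (hUV : T.IsCotorsionPair U V)
    (hP : T.EnoughProjectives) {C₁ C₀ : B} (hC₁ : T.coheart U C₁) (hC₀ : T.coheart U C₀)
    (f : C₁ ⟶ C₀) :
    ∃ (X : B) (_ : T.plus U V X ∧ T.minus U V X) (δ : Ext T.E C₀ X),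
      T.Presents (T.coheart U) f δ := by
  obtain ⟨P, hPP, p, hp⟩ := hP C₀
  obtain ⟨X, i, δ, hδ⟩ := T.exists_conflation_desc f hp
  have hM : U ((C₁ ⊞ C₁) ⊞ P) := hUV.left.biprod _ _ (hUV.left.biprod _ _ hC₁.1 hC₁.1)
    (hUV.projectives_le _ hPP)
  -- `δ` already presents the extensions by `X`, but `X` need not lie in `B⁺`; hence the passage to
  -- `G`.
  have hX : T.minus U V X := hUV.minus_of_cocone ⟨_, _, hM, hC₀.1, _, _, δ, hδ⟩
  obtain ⟨G, A, d, e, ⟨γ, hγ⟩, hG, hA, K, W₀, hK, j, q, h, ⟨θ, hθ⟩, hq⟩ := hUV.exists_plus X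
  refine ⟨G, ⟨hG, hUV.minus_of_conflation ⟨γ, hγ⟩ hX hA⟩, push d δ, fun C hC =>
    ⟨fun ξ => ?_, fun c => ⟨fun hc => ?_, ?_⟩⟩⟩
  · obtain ⟨ξ, rfl⟩ := exists_push_inflation_eq hγ ξ (hC.2 _ hA _)
    obtain ⟨c, rfl⟩ := exists_pull_eq hδ ξ (hC.2 _ hM _)
    exact ⟨c, (push_pull _ _ _).symm⟩
  · rw [← push_pull] at hc
    -- Passing from `X` to `G` loses no class on the coheart: `a : C ⟶ A` lifts to `W₀` because
    -- `𝔼(C, K) = 0`, hence to `G`, so `a^* γ = 0`.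
    obtain ⟨a, ha⟩ := exists_pull_eq hγ _ hc
    obtain ⟨b, rfl⟩ := (pull_eq_zero_iff hθ a).1 (hC.2 _ hK _)
    rw [(pull_eq_zero_iff hγ (b ≫ q)).2 ⟨b ≫ h, by simp [hq]⟩] at ha
    obtain ⟨t, rfl⟩ := (pull_eq_zero_iff hδ c).1 ha.symm
    -- The second copy of `C₁` carries `f`; the component through `P` is the error absorbed by the
    -- ideal.
    refine ⟨t ≫ biprod.fst ≫ biprod.snd, AddSubgroup.subset_closure
      ⟨P, hPP, t ≫ biprod.snd, p, ?_⟩⟩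
    rw [eq_sub_iff_add_eq, biprod.desc_eq]
    simp [add_comm]
  · rintro ⟨g, hg⟩
    rw [← sub_add_cancel c (g ≫ f), T.pull_add, pull_eq_zero_of_mem_ideal hg, zero_add,
      ← push_pull, (pull_eq_zero_iff hδ _).2 ⟨g ≫ biprod.inr ≫ biprod.inl, by simp⟩, push_zero_right]

end Extriangulation

end Extri

noncomputable section

namespace Extri

/-! ### Subquotient categories, small models and quotient functors. -/

section SubQuotient

variable {B : Type u} [Category.{v} B] [Preadditive B] {S W : ObjectProperty B}

/-- The object of `S/W` given by an object of `S`. -/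
abbrev subObj (W : ObjectProperty B) {X : B} (hX : S X) : SubQuotient S W := ⟨⟨X⟩, hX⟩

/-- The class in `S/W` of a morphism between objects of `S`. -/
def subMap (W : ObjectProperty B) {X Y : B} (hX : S X) (hY : S Y) (f : X ⟶ Y) :
    subObj W hX ⟶ subObj W hY :=
  ObjectProperty.homMk ((CategoryTheory.Quotient.functor (idealRel W)).map f)

theorem subMap_surjective {X Y : B} (hX : S X) (hY : S Y) :
    Function.Surjective (subMap W hX hY) := fun f => by
  obtain ⟨f, hf⟩ := (CategoryTheory.Quotient.functor (idealRel W)).map_surjective f.hom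
  exact ⟨f, ObjectProperty.hom_ext _ hf⟩

theorem subMap_comp {X Y Z : B} (hX : S X) (hY : S Y) (hZ : S Z) (f : X ⟶ Y) (g : Y ⟶ Z) :
    subMap W hX hY f ≫ subMap W hY hZ g = subMap W hX hZ (f ≫ g) :=
  ObjectProperty.hom_ext _ ((CategoryTheory.Quotient.functor (idealRel W)).map_comp f g).symm

theorem subMap_eq_iff {X Y : B} (hX : S X) (hY : S Y) (f g : X ⟶ Y) :
    subMap W hX hY f = subMap W hX hY g ↔ f - g ∈ ideal W X Y := by
  refine Iff.trans ?_ (CategoryTheory.Quotient.functor_map_eq_iff (idealRel W) f g)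
  exact ⟨fun h => (ObjectProperty.ι _).congr_map h, fun h => ObjectProperty.hom_ext _ h⟩

end SubQuotient

section Shrinking

variable {M N : Type w} [AddCommGroup M] [AddCommGroup N] [Small.{v} M] [Small.{v} N]

/-- The homomorphism between small models induced by a homomorphism. -/
def shrinkMap (f : M →+ N) : Shrink.{v} M →+ Shrink.{v} N :=
  (Shrink.addEquiv.symm.toAddMonoidHom.comp f).comp Shrink.addEquiv.toAddMonoidHom

@[simp] theorem addEquiv_shrinkMap (f : M →+ N) (x : Shrink.{v} M) :
    Shrink.addEquiv (shrinkMap f x) = f (Shrink.addEquiv x) := by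
  simp [shrinkMap]

end Shrinking

/-- Two quotients of a functor with the same kernel are isomorphic. -/
theorem nonempty_iso_of_surjective {D : Type*} [Category* D] {G F F' : D ⥤ AddCommGrpCat.{v}}
    (π : G ⟶ F) (π' : G ⟶ F') (hπ : ∀ Z, Function.Surjective (π.app Z))
    (hπ' : ∀ Z, Function.Surjective (π'.app Z))
    (h : ∀ Z (x : G.obj Z), π.app Z x = 0 ↔ π'.app Z x = 0) : Nonempty (F ≅ F') := by
  have key : ∀ Z, ∃ e : F.obj Z ≃+ F'.obj Z, ∀ x, e (π.app Z x) = π'.app Z x := fun Z => by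
    let e₁ := QuotientAddGroup.quotientKerEquivOfSurjective (π.app Z).hom (hπ Z)
    let e₂ := QuotientAddGroup.quotientKerEquivOfSurjective (π'.app Z).hom (hπ' Z)
    have hk : (π.app Z).hom.ker = (π'.app Z).hom.ker := AddSubgroup.ext (h Z)
    refine ⟨e₁.symm.trans ((QuotientAddGroup.quotientAddEquivOfEq hk).trans e₂), fun x => ?_⟩
    have : e₁.symm (π.app Z x) = (x : G.obj Z ⧸ (π.app Z).hom.ker) :=
      e₁.symm_apply_apply (x : G.obj Z ⧸ (π.app Z).hom.ker)
    simp only [AddEquiv.trans_apply, this]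
    rfl
  choose e he using key
  refine ⟨NatIso.ofComponents (fun Z => (e Z).toAddCommGrpIso) fun {Z Z'} f => ?_⟩
  ext y
  obtain ⟨x, rfl⟩ := hπ Z y
  have h₁ := ConcreteCategory.congr_hom (π.naturality f) x
  have h₂ := ConcreteCategory.congr_hom (π'.naturality f) x
  change e Z' (F.map f (π.app Z x)) = F'.map f (e Z (π.app Z x))
  rw [he]
  exact (congrArg (e Z') h₁.symm).trans ((he Z' _).trans h₂)

/-! ### The extension functor on a subcategory modulo projectives. -/

namespace Extriangulation

variable {B : Type u} [Category.{v} B] [Preadditive B] [HasBinaryBiproducts B]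
  {T : Extriangulation.{w} B}

/-- If there are enough projectives, then the groups of extensions are as small as the groups of
morphisms. -/
theorem EnoughProjectives.small_ext (hP : T.EnoughProjectives) (C A : B) :
    Small.{v} (Ext T.E C A) := by
  obtain ⟨P, hPP, y, X, x, δ, hδ⟩ := hP C
  -- Since `𝔼(P, A) = 0`, every extension is a push of the one class `δ`.
  exact small_of_surjective (f := fun a : X ⟶ A => push a δ) fun ξ =>
    exists_push_eq hδ ξ (hPP _ _)

/-- The pullback of extensions along a morphism modulo projective objects. -/
def pullHom {C C' : AddQuotient T.projectives} (f : C ⟶ C') (X : B) :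
    Ext T.E C'.as X →+ Ext T.E C.as X :=
  Quot.lift (fun c : C.as ⟶ C'.as => ((T.E.map c.op).app X).hom) (fun c c' h => by
    rw [HomRel.compClosure_iff_self] at h
    ext δ
    have h' := pull_eq_zero_of_mem_ideal h δ
    rwa [T.pull_sub, sub_eq_zero] at h') f

section

variable {S : ObjectProperty B}

theorem pullHom_comp {C C' C'' : AddQuotient T.projectives} (f : C ⟶ C') (g : C' ⟶ C'') {X : B}
    (δ : Ext T.E C''.as X) : pullHom (f ≫ g) X δ = pullHom f X (pullHom g X δ) := by
  obtain ⟨f, rfl⟩ := (CategoryTheory.Quotient.functor _).map_surjective f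
  obtain ⟨g, rfl⟩ := (CategoryTheory.Quotient.functor _).map_surjective g
  exact pull_comp g f δ

theorem pullHom_add {C C' : AddQuotient T.projectives} (f g : C ⟶ C') {X : B}
    (δ : Ext T.E C'.as X) : pullHom (f + g) X δ = pullHom f X δ + pullHom g X δ := by
  obtain ⟨f, rfl⟩ := (CategoryTheory.Quotient.functor _).map_surjective f
  obtain ⟨g, rfl⟩ := (CategoryTheory.Quotient.functor _).map_surjective g
  exact T.pull_add f g δ

theorem push_pullHom {C C' : AddQuotient T.projectives} (f : C ⟶ C') {X Y : B} (a : X ⟶ Y)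
    (δ : Ext T.E C'.as X) : push a (pullHom f X δ) = pullHom f Y (push a δ) := by
  obtain ⟨f, rfl⟩ := (CategoryTheory.Quotient.functor _).map_surjective f
  exact push_pull a f δ

variable [∀ C X : B, Small.{v} (Ext T.E C X)]

variable (T S) in
/-- The functor `𝔼(-, X)` on `S` modulo projective objects. -/
def extFunctor (X : B) : (SubQuotient S T.projectives)ᵒᵖ ⥤ AddCommGrpCat.{v} where
  obj Z := .of (Shrink.{v} (Ext T.E Z.unop.obj.as X))
  map f := AddCommGrpCat.ofHom (shrinkMap (pullHom f.unop.hom X))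
  map_id Z := by
    refine AddCommGrpCat.hom_ext (AddMonoidHom.ext fun x => ?_)
    exact Shrink.addEquiv.injective ((addEquiv_shrinkMap _ _).trans (pull_id _))
  map_comp f g := by
    refine AddCommGrpCat.hom_ext (AddMonoidHom.ext fun x => ?_)
    refine Shrink.addEquiv.injective ((addEquiv_shrinkMap _ _).trans ?_)
    refine (pullHom_comp g.unop.hom f.unop.hom _).trans (Eq.symm ?_)
    exact (addEquiv_shrinkMap _ _).trans (congrArg _ (addEquiv_shrinkMap _ _))

/-- The value of `extFunctor` at an object. -/
def extEquiv (Z : (SubQuotient S T.projectives)ᵒᵖ) (X : B) :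
    (extFunctor T S X).obj Z ≃+ Ext T.E Z.unop.obj.as X :=
  Shrink.addEquiv

theorem extEquiv_map {Z Z' : (SubQuotient S T.projectives)ᵒᵖ} (f : Z ⟶ Z') {X : B}
    (x : (extFunctor T S X).obj Z) :
    extEquiv Z' X ((extFunctor T S X).map f x) = pullHom f.unop.hom X (extEquiv Z X x) :=
  addEquiv_shrinkMap _ _

instance (X : B) : (extFunctor T S X).Additive where
  map_add {Z Z' f g} := by
    ext x
    apply (extEquiv Z' X).injective
    rw [AddCommGrpCat.hom_add_apply, map_add, extEquiv_map, extEquiv_map, extEquiv_map]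
    exact pullHom_add f.unop.hom g.unop.hom _

variable (T S) in
/-- The natural transformation induced by a morphism. -/
def extFunctorMap {X Y : B} (a : X ⟶ Y) : extFunctor T S X ⟶ extFunctor T S Y where
  app Z := AddCommGrpCat.ofHom (shrinkMap ((T.E.obj (op Z.unop.obj.as)).map a).hom)
  naturality Z Z' f := by
    ext x
    refine Shrink.addEquiv.injective ((addEquiv_shrinkMap _ _).trans ?_)
    refine (congrArg _ (addEquiv_shrinkMap _ _)).trans (Eq.symm ?_)
    refine (addEquiv_shrinkMap _ _).trans ((congrArg _ (addEquiv_shrinkMap _ _)).trans ?_)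
    exact (push_pullHom f.unop.hom a _).symm

theorem extEquiv_extFunctorMap {X Y : B} (a : X ⟶ Y) (Z : (SubQuotient S T.projectives)ᵒᵖ)
    (x : (extFunctor T S X).obj Z) :
    extEquiv Z Y ((extFunctorMap T S a).app Z x) = push a (extEquiv Z X x) :=
  addEquiv_shrinkMap _ _

variable (T S) in
/-- The functor which sends `X` to the restriction of `𝔼(-, X)` to `S`. -/
def extRestriction : B ⥤ (SubQuotient S T.projectives)ᵒᵖ ⥤ AddCommGrpCat.{v} where
  obj X := extFunctor T S X
  map a := extFunctorMap T S a
  map_id X := by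
    ext Z x
    exact (extEquiv Z X).injective ((extEquiv_extFunctorMap _ _ _).trans (push_id _))
  map_comp {X Y Y'} a b := by
    ext Z x
    refine (extEquiv Z Y').injective ((extEquiv_extFunctorMap _ _ _).trans ?_)
    refine (push_comp _ _ _).trans (Eq.symm ?_)
    exact (extEquiv_extFunctorMap _ _ _).trans (congrArg _ (extEquiv_extFunctorMap _ _ _))

theorem extFunctorMap_add {X Y : B} (a b : X ⟶ Y) :
    extFunctorMap T S (a + b) = extFunctorMap T S a + extFunctorMap T S b := by
  ext Z x
  apply (extEquiv Z Y).injective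
  refine (extEquiv_extFunctorMap _ _ _).trans ((T.push_add _ _ _).trans (Eq.symm ?_))
  refine ((extEquiv Z Y).map_add _ _).trans ?_
  exact congrArg₂ _ (extEquiv_extFunctorMap _ _ _) (extEquiv_extFunctorMap _ _ _)

/-- The natural transformation which corresponds to an extension by the Yoneda lemma. -/
def extYoneda {C X : B} (hC : S C) (δ : Ext T.E C X) :
    preadditiveYoneda.obj (subObj T.projectives hC) ⟶ extFunctor T S X where
  app Z := AddCommGrpCat.ofHom (AddMonoidHom.mk'
    (fun f : Z.unop ⟶ subObj T.projectives hC => (extEquiv Z X).symm (pullHom f.hom X δ))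
    fun f g => (congrArg (extEquiv Z X).symm
      (pullHom_add (InducedCategory.Hom.hom f) (InducedCategory.Hom.hom g) δ)).trans
        (map_add (extEquiv Z X).symm _ _))
  naturality Z Z' f := by
    ext g
    apply (extEquiv Z' X).injective
    refine ((extEquiv Z' X).apply_symm_apply _).trans ?_
    refine (pullHom_comp f.unop.hom (InducedCategory.Hom.hom g) δ).trans (Eq.symm ?_)
    exact (extEquiv_map _ _).trans (congrArg _ ((extEquiv Z X).apply_symm_apply _))

theorem extEquiv_extYoneda {C X : B} (hC : S C) (δ : Ext T.E C X)
    (Z : (SubQuotient S T.projectives)ᵒᵖ) (f : Z.unop ⟶ subObj T.projectives hC) :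
    extEquiv Z X ((extYoneda hC δ).app Z f) = pullHom f.hom X δ :=
  (extEquiv Z X).apply_symm_apply _

theorem Presents.surjective {C₁ C₀ X : B} {f : C₁ ⟶ C₀} {δ : Ext T.E C₀ X}
    (h : T.Presents S f δ) (hC₀ : S C₀) (Z : (SubQuotient S T.projectives)ᵒᵖ) :
    Function.Surjective ((extYoneda hC₀ δ).app Z) := fun x => by
  obtain ⟨c, hc⟩ := (h _ Z.unop.property).1 (extEquiv Z X x)
  exact ⟨subMap T.projectives Z.unop.property hC₀ c, (extEquiv Z X).injective
    ((extEquiv_extYoneda hC₀ δ Z _).trans hc)⟩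

theorem Presents.exact {C₁ C₀ X : B} {f : C₁ ⟶ C₀} {δ : Ext T.E C₀ X}
    (h : T.Presents S f δ) (hC₁ : S C₁) (hC₀ : S C₀) (Z : (SubQuotient S T.projectives)ᵒᵖ) :
    Function.Exact ((preadditiveYoneda.map (subMap T.projectives hC₁ hC₀ f)).app Z)
      ((extYoneda hC₀ δ).app Z) := fun c => by
  obtain ⟨c, rfl⟩ := subMap_surjective Z.unop.property hC₀ c
  rw [← (extEquiv Z X).map_eq_zero_iff]
  refine (Eq.congr_left (extEquiv_extYoneda hC₀ δ Z _)).trans ?_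
  refine ((h _ Z.unop.property).2 c).trans ⟨?_, ?_⟩
  · rintro ⟨g, hg⟩
    refine ⟨subMap T.projectives Z.unop.property hC₁ g, ?_⟩
    exact (subMap_comp Z.unop.property hC₁ hC₀ g f).trans
      ((subMap_eq_iff Z.unop.property hC₀ _ _).2 hg).symm
  · rintro ⟨g, hg⟩
    obtain ⟨g, rfl⟩ := subMap_surjective Z.unop.property hC₁ g
    refine ⟨g, (subMap_eq_iff Z.unop.property hC₀ _ _).1 ?_⟩
    exact hg.symm.trans (subMap_comp Z.unop.property hC₁ hC₀ g f)

theorem Presents.isCoherent {C₁ C₀ X : B} {f : C₁ ⟶ C₀} {δ : Ext T.E C₀ X}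
    (h : T.Presents S f δ) (hC₁ : S C₁) (hC₀ : S C₀) :
    isCoherent (SubQuotient S T.projectives) (extFunctor T S X) :=
  ⟨inferInstance, _, _, _, extYoneda hC₀ δ, fun Z => ⟨h.exact hC₁ hC₀ Z, h.surjective hC₀ Z⟩⟩

end

/-! ### The functor on the heart and its equivalence properties. -/

section Heart

variable {U V : ObjectProperty B} [∀ C X : B, Small.{v} (Ext T.E C X)]

variable (T U V) in
/-- The objects of the heart. -/
abbrev heartObjects : ObjectProperty B := fun X => T.plus U V X ∧ T.minus U V X

variable (U V) in
/-- The functor from the heart to the coherent functors on the coheart modulo projectives. -/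
def heartFunctor (hCK : T.IsCotorsionPair (T.coheart U) (T.kernel U V)) :
    T.Heart U V ⥤ Mod (SubQuotient (T.coheart U) T.projectives) :=
  (isCoherent _).lift
    (ObjectProperty.ι _ ⋙ CategoryTheory.Quotient.lift _ (extRestriction T (T.coheart U)) (fun X Y f g h => by
      ext Z x
      apply (extEquiv Z Y).injective
      refine (extEquiv_extFunctorMap _ _ _).trans (Eq.trans ?_ (extEquiv_extFunctorMap _ _ _).symm)
      rw [← sub_eq_zero, ← T.push_sub]
      exact push_eq_zero_of_mem_ideal h (fun W hW => Z.unop.property.2 W hW.1) _))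
    fun X => by
      obtain ⟨C₁, C₀, hC₁, hC₀, f, δ, h⟩ := hCK.exists_presentation X.obj.as
      exact h.isCoherent hC₁ hC₀

variable (hCK : T.IsCotorsionPair (T.coheart U) (T.kernel U V))

theorem heartFunctor_additive : (heartFunctor U V hCK).Additive where
  map_add {X Y f g} := by
    obtain ⟨f, rfl⟩ := subMap_surjective (S := T.heartObjects U V) X.property Y.property f
    obtain ⟨g, rfl⟩ := subMap_surjective (S := T.heartObjects U V) X.property Y.property g
    exact ObjectProperty.hom_ext _ (extFunctorMap_add f g)

/-- Evaluating at the universal class shows that the difference of two morphisms with equal images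
kills it, hence factors through the core. -/
theorem heartFunctor_faithful (hUV : T.IsCotorsionPair U V) :
    (heartFunctor U V hCK).Faithful where
  map_injective {X Y f g} h := by
    obtain ⟨f, rfl⟩ := subMap_surjective (S := T.heartObjects U V) X.property Y.property f
    obtain ⟨g, rfl⟩ := subMap_surjective (S := T.heartObjects U V) X.property Y.property g
    obtain ⟨C, hC, δ, -, -, hδ⟩ := hUV.exists_universal_extension hCK X.property.2
    refine (subMap_eq_iff (S := T.heartObjects U V) X.property Y.property f g).2
      (AddSubgroup.subset_closure (hδ _ Y.property.1 _ ?_))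
    let Z := op (subObj T.projectives hC)
    have h' := ConcreteCategory.congr_hom (NatTrans.congr_app
      (congrArg InducedCategory.Hom.hom h) Z) ((extEquiv Z X.obj.as).symm δ)
    have h'' := congrArg (extEquiv Z Y.obj.as) h'
    have e (a : X.obj.as ⟶ Y.obj.as) := extEquiv_extFunctorMap (T := T) a Z
      ((extEquiv Z X.obj.as).symm δ)
    rw [T.push_sub, sub_eq_zero]
    simp only [AddEquiv.apply_symm_apply] at e
    exact (e f).symm.trans (h''.trans (e g))

/-- By naturality `η` is determined by the image `ε` of the universal class `δ`, so it suffices to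
write `ε` as `f_* δ`. -/
theorem heartFunctor_full (hUV : T.IsCotorsionPair U V) : (heartFunctor U V hCK).Full where
  map_surjective {X Y} η := by
    obtain ⟨C, hC, δ, hδ, hδ', -⟩ := hUV.exists_universal_extension hCK X.property.2
    let τ : extFunctor T (T.coheart U) X.obj.as ⟶ extFunctor T (T.coheart U) Y.obj.as := η.hom
    let Z := op (subObj T.projectives hC)
    let ε : Ext T.E C Y.obj.as := extEquiv Z Y.obj.as (τ.app Z ((extEquiv Z X.obj.as).symm δ))
    have key (C' : B) (hC' : T.coheart U C') (c : C' ⟶ C) (x) (hx : extEquiv (op (subObj _ hC'))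
        X.obj.as x = pull c δ) : extEquiv (op (subObj _ hC')) Y.obj.as (τ.app _ x) = pull c ε := by
      have hx' : x = (extFunctor T (T.coheart U) X.obj.as).map
          (subMap T.projectives hC' hC c).op ((extEquiv Z X.obj.as).symm δ) := by
        apply (extEquiv (op (subObj T.projectives hC')) X.obj.as).injective
        rw [hx, extEquiv_map, AddEquiv.apply_symm_apply]
        rfl
      have hτ := ConcreteCategory.congr_hom (τ.naturality (subMap T.projectives hC' hC c).op)
        ((extEquiv Z X.obj.as).symm δ)
      rw [hx']
      exact (congrArg _ hτ).trans (extEquiv_map _ _)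
    obtain ⟨f, hf⟩ := hδ' Y.obj.as Y.property.1 ε fun C' hC' c hc => by
      rw [← key C' hC' c 0 (by rw [hc, map_zero]), map_zero, map_zero]
    refine ⟨subMap (S := T.heartObjects U V) (core U V) X.property Y.property f, ObjectProperty.hom_ext _ ?_⟩
    change extFunctorMap T (T.coheart U) f = τ
    ext Z' x
    obtain ⟨c, hc⟩ := hδ _ Z'.unop.property (extEquiv Z' X.obj.as x)
    apply (extEquiv Z' Y.obj.as).injective
    refine (extEquiv_extFunctorMap _ _ _).trans (Eq.trans ?_
      (key _ Z'.unop.property c x hc.symm).symm)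
    rw [← hc, push_pull, hf]

/-- A coherent functor is the cokernel of a morphism that lifts to the coheart; the heart object
built from the lift has the same presentation. -/
theorem heartFunctor_essSurj (hUV : T.IsCotorsionPair U V) (hP : T.EnoughProjectives) :
    (heartFunctor U V hCK).EssSurj where
  mem_essImage F := by
    obtain ⟨F, hF, C₁, C₀, f, π, hπ⟩ := F
    obtain ⟨f, rfl⟩ := subMap_surjective C₁.property C₀.property f
    obtain ⟨X, hX, δ, h⟩ := hUV.exists_heart_of_hom hP C₁.property C₀.property f
    obtain ⟨e⟩ := nonempty_iso_of_surjective (extYoneda C₀.property δ) π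
      (h.surjective C₀.property) (fun Z => (hπ Z).2) fun Z x =>
        (h.exact C₁.property C₀.property Z x).trans ((hπ Z).1 x).symm
    exact ⟨subObj _ hX, ⟨ObjectProperty.isoMk _ e⟩⟩

end Heart

end Extriangulation

end Extri

end

theorem mainTheorem6 {B : Type u} [Category.{v} B] [Preadditive B] [HasZeroObject B]
    [HasBinaryBiproducts B]
    (T : Extri.Extriangulation.{w} B) (hP : T.EnoughProjectives)
    (U V : ObjectProperty B) (hUV : T.IsCotorsionPair U V)
    (hCK : T.IsCotorsionPair (T.coheart U) (T.kernel U V)) :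
    ∃ e : T.Heart U V ≌ Extri.Mod (Extri.SubQuotient (T.coheart U) T.projectives),
      e.functor.Additive := by
  have := hP.small_ext
  have := Extri.Extriangulation.heartFunctor_faithful hCK hUV
  have := Extri.Extriangulation.heartFunctor_full hCK hUV
  have := Extri.Extriangulation.heartFunctor_essSurj hCK hUV hP
  have : (Extri.Extriangulation.heartFunctor U V hCK).IsEquivalence := {}
  exact ⟨(Extri.Extriangulation.heartFunctor U V hCK).asEquivalence,
    Extri.Extriangulation.heartFunctor_additive hCK⟩
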